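/- For $n\in\mathbb{N}=\{1,2,\dots\}$ let $(U_j^{(n)})_{j\ge 1}$ be independent random variables, uniformly distributed on $\{1,\dots,n\}$. For $1\le m\le n$ let $$\tau^{(n)}(m)=\inf\{j\in\mathbb{N}:\ \text{there are exactly } m \text{ different values among } U_1^{(n)},\dots,U_j^{(n)}\},$$ let $\tau^{(n)}(m)=\tau^{(n)}(n)$ for $m>n$, and put $B_n(m)=\{U_1^{(n)},U_2^{(n)},\dots,U_{\tau^{(n)}(m)}^{(n)}\}$ for all $m\in\mathbb N$. (For each $m\le n$, $B_n(m)$ is uniformly distributed among the $m$-element subsets of $\{1,\dots,n\}$.) Let $(U_j)_{j\ge1}$ be independent random variables with the uniform distribution on $[0,1]$, and let $(\mathcal G_k(p))_{k\ge 1,\ p\text{ prime}}$ be mutually independent random variables with values in $\{0,1,2,\dots\}$, independent of $(U_j)_{j\ge 1}$, such that $\mathbb P\{\mathcal G_k(p)\ge j\}=p^{-j}$ for all $j\ge 0$, $k\ge 1$ and all primes $p$. Then, almost surely, the series over the primes below converges for every $m\in\mathbb N$, and $$\Big(\log \mathrm{lcm}(B_n(m))-m\log n\Big)_{m\in\mathbb{N}}\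 \longrightarrow\ \Big(\sum_{j=1}^m\log U_j+\sum_{p\text{ prime}} \log p\cdot\Big(\max_{1\le k\le m}\mathcal G_k(p)-\sum_{k=1}^m\mathcal G_k(p)\Big)\Big)_{m\in\mathbb{N}}$$ as $n\to\infty$, in distribution in $\mathbb{R}^\infty$ endowed with the product topology. -/

import Mathlib

open MeasureTheory ProbabilityTheory Filter
open scoped ENNReal

noncomputable section

namespace RandomLcm

/-- The set of distinct values among the first `j` terms of a sequence. Sequences are indexed
from `0`, so `u 0, …, u (j - 1)` are the terms which are usually written `u₁, …, u_j`. -/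
def values (u : ℕ → ℕ) (j : ℕ) : Finset ℕ := (Finset.range j).image u

/-- The coupon collector time `τ⁽ⁿ⁾(m)`: the least `j` such that there are exactly `m` different
values among the first `j` terms of the sequence, with `τ⁽ⁿ⁾(m) = τ⁽ⁿ⁾(n)` for `m > n`.
(For sequences in which no such `j` exists, a null event for independent uniform samples of
`{1, …, n}`, the value is `0`.) -/
def couponTime (n m : ℕ) (u : ℕ → ℕ) : ℕ := sInf {j : ℕ | (values u j).card = min m n}

/-- The random set `B_n(m) = {u₁, …, u_{τ⁽ⁿ⁾(m)}}`. -/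
def randomSubset (n m : ℕ) (u : ℕ → ℕ) : Finset ℕ := values u (couponTime n m u)

/-- `log lcm (B_n(m)) - m log n`. -/
def logLcmCentered (n m : ℕ) (u : ℕ → ℕ) : ℝ :=
  Real.log (((randomSubset n m u).lcm id : ℕ) : ℝ) - (m : ℝ) * Real.log (n : ℝ)

/-- `log p · (max_{1 ≤ k ≤ m} g_k(p) - ∑_{k=1}^m g_k(p))`. As `g` takes values in `ℕ`, the
supremum in `ℕ` over the first `m ≥ 1` terms is their maximum. -/
def limitTerm (m : ℕ) (g : ℕ → Nat.Primes → ℕ) (p : Nat.Primes) : ℝ :=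
  Real.log (p : ℝ) *
    ((((Finset.range m).sup fun k => g k p : ℕ) : ℝ) - ∑ k ∈ Finset.range m, (g k p : ℝ))

/-- `∑_{j=1}^m log v_j + ∑_p log p · (max_{1 ≤ k ≤ m} g_k(p) - ∑_{k=1}^m g_k(p))`. -/
def limitValue (m : ℕ) (v : ℕ → ℝ) (g : ℕ → Nat.Primes → ℕ) : ℝ :=
  ∑ j ∈ Finset.range m, Real.log (v j) + ∑' p : Nat.Primes, limitTerm m g p

end RandomLcm

end

/-! With probability at least `1 - m² / n` the first `m` draws are distinct. Then `τ(m) = m`, and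
since `log N = ∑ p, v_p(N) log p`, the centred log-lcm equals exactly the limit functional evaluated
at `U_j / n` and `v_p(U_j)` (`logLcmCentered_eq_limitValue`). It remains to pass to the limit in the
arguments of this functional.

For `t ≤ 1` there are `⌊t n⌋ / Q` multiples of `Q` up to `t n`, a proportion tending to `t / Q`.
With `Q = ∏ p ^ a p` this gives joint convergence of sizes and exponents to independent uniform and
geometric variables, read off from orthant probabilities.

The sum over all primes is not continuous in the exponents, so it is truncated to a finite set `S`.
The error is controlled by `|max - sum| ≤ ∑_{i ≠ j} min (g i) (g j)` (`sum_le_sup_add_sum_min`): two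
independent exponents both reach `a` with probability at most `p ^ (-2a)`, so the term at `p` has
first moment `O(log p / p²)`, summable and uniform in `n`. `tendstoInDistribution_pi_of_approx`
removes the truncation. -/

/-! ### Weak convergence in countable products of lines -/

open scoped Topology in
/-- Probability measures on a countable product of lines which converge on all finite dimensional
lower orthants converge weakly. -/
theorem tendsto_probabilityMeasure_pi_of_tendsto_orthant {ι κ : Type*} [Countable ι]
    {l : Filter κ} [l.IsCountablyGenerated] {μ : κ → ProbabilityMeasure (ι → ℝ)}
    {ν : ProbabilityMeasure (ι → ℝ)}
    (h : ∀ (T : Finset ι) (x : ι → ℝ),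
      Tendsto (fun n => (μ n : Measure (ι → ℝ)).real {w | ∀ i ∈ T, w i ≤ x i}) l
        (𝓝 ((ν : Measure (ι → ℝ)).real {w | ∀ i ∈ T, w i ≤ x i}))) :
    Tendsto μ l (𝓝 ν) := by
  classical
  -- Half-open intervals are stable under intersection and arise from half-lines by subtraction;
  -- `Set.univ` lets cylinders over different index sets be intersected.
  let C : ι → Set (Set ℝ) := fun _ => insert Set.univ {S | ∃ a b : ℝ, a < b ∧ Set.Ioc a b = S}
  have hCmeas : ∀ i, ∀ s ∈ C i, MeasurableSet s := by
    rintro i s (rfl | ⟨a, b, -, rfl⟩)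
    · exact MeasurableSet.univ
    · exact measurableSet_Ioc
  have horth : ∀ (T : Finset ι) (x : ι → ℝ), MeasurableSet {w : ι → ℝ | ∀ i ∈ T, w i ≤ x i} := by
    intro T x
    have : {w : ι → ℝ | ∀ i ∈ T, w i ≤ x i} = (T : Set ι).pi fun i => Set.Iic (x i) := by
      ext w; simp [Set.mem_pi]
    rw [this]
    exact MeasurableSet.pi T.countable_toSet fun i _ => measurableSet_Iic
  have hpi : IsPiSystem (squareCylinders C) :=
    isPiSystem_squareCylinders (fun i => (isPiSystem_Ioc id id).insert_univ)
      fun i => Set.mem_insert _ _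
  have hcut : ∀ (T : Finset ι) (x : ι → ℝ) (q : ι) (b : ℝ), ∃ (T' : Finset ι) (x' : ι → ℝ),
      {w : ι → ℝ | ∀ i ∈ T, w i ≤ x i} ∩ {w | w q ≤ b} = {w | ∀ i ∈ T', w i ≤ x' i} := by
    intro T x q b
    refine ⟨insert q T, Function.update x q (if q ∈ T then min (x q) b else b), ?_⟩
    ext w
    simp only [Set.mem_inter_iff, Set.mem_ofPred_eq, Finset.forall_mem_insert, Function.update_self]
    constructor
    · rintro ⟨h1, h2⟩
      refine ⟨by split_ifs with hq <;> simp_all, fun i hi => ?_⟩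
      by_cases hiq : i = q
      · subst hiq; simp [hi, h1 i hi, h2]
      · simpa [hiq] using h1 i hi
    · rintro ⟨h1, h2⟩
      refine ⟨fun i hi => ?_, by split_ifs at h1 with hq <;> simp_all⟩
      by_cases hiq : i = q
      · subst hiq
        have := h2 i hi
        simp [hi] at this
        exact this.1
      · simpa [hiq] using h2 i hi
  -- The orthant is kept arbitrary so that the induction closes: imposing `a < w q ≤ b` gives the
  -- difference of two sets of the same form, with the orthant cut at `b` and at `a`.
  have hbox : ∀ (s : Finset ι) (t : ι → Set ℝ), (∀ i, t i ∈ C i) → ∀ (T : Finset ι) (x : ι → ℝ),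
      Tendsto (fun n => (μ n : Measure (ι → ℝ)).real
          ({w | ∀ i ∈ T, w i ≤ x i} ∩ (s : Set ι).pi t)) l
        (𝓝 ((ν : Measure (ι → ℝ)).real ({w | ∀ i ∈ T, w i ≤ x i} ∩ (s : Set ι).pi t))) := by
    intro s t ht
    induction s using Finset.induction_on with
    | empty => intro T x; simpa using h T x
    | insert q s hq ih =>
      intro T x
      rcases ht q with hu | ⟨a, b, hab, hab'⟩
      · simpa [Set.insert_pi, hu] using ih T x
      · obtain ⟨T₁, x₁, h₁⟩ := hcut T x q b
        obtain ⟨T₂, x₂, h₂⟩ := hcut T x q a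
        have hset : {w : ι → ℝ | ∀ i ∈ T, w i ≤ x i} ∩ ((insert q s : Finset ι) : Set ι).pi t =
            ({w | ∀ i ∈ T₁, w i ≤ x₁ i} ∩ (s : Set ι).pi t) \
              ({w | ∀ i ∈ T₂, w i ≤ x₂ i} ∩ (s : Set ι).pi t) := by
          rw [← h₁, ← h₂]
          ext w
          simp only [Finset.coe_insert, Set.insert_pi, ← hab', Set.mem_inter_iff, Set.mem_sdiff,
            Set.mem_ofPred_eq, Set.mem_preimage, Function.eval, Set.mem_Ioc]
          constructor
          · rintro ⟨h1, ⟨h2, h3⟩, h4⟩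
            exact ⟨⟨⟨h1, h3⟩, h4⟩, fun h5 => absurd h5.1.2 (not_le.2 h2)⟩
          · rintro ⟨⟨⟨h1, h3⟩, h4⟩, h5⟩
            exact ⟨h1, ⟨lt_of_not_ge fun h6 => h5 ⟨⟨h1, h6⟩, h4⟩, h3⟩, h4⟩
        have hsub : ({w : ι → ℝ | ∀ i ∈ T₂, w i ≤ x₂ i} ∩ (s : Set ι).pi t) ⊆
            ({w | ∀ i ∈ T₁, w i ≤ x₁ i} ∩ (s : Set ι).pi t) := by
          rw [← h₁, ← h₂]
          gcongr
        have hm : MeasurableSet ({w : ι → ℝ | ∀ i ∈ T₂, w i ≤ x₂ i} ∩ (s : Set ι).pi t) :=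
          (horth _ _).inter (MeasurableSet.pi s.countable_toSet fun i _ => hCmeas i _ (ht i))
        rw [hset]
        refine Tendsto.congr (fun n => (measureReal_sdiff hsub hm).symm) ?_
        rw [measureReal_sdiff hsub hm]
        exact (ih T₁ x₁).sub (ih T₂ x₂)
  refine hpi.tendsto_probabilityMeasure_of_tendsto_of_mem ?_ ?_ ?_
  · rintro _ ⟨s, t, ht, rfl⟩
    exact MeasurableSet.pi s.countable_toSet fun i _ => hCmeas i _ (ht i trivial)
  · intro u hu x hx
    obtain ⟨s, v, hv, hvu⟩ := isOpen_pi_iff.1 hu x hx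
    have hex : ∀ i, ∃ ε > 0, i ∈ s → Metric.ball (x i) ε ⊆ v i := by
      intro i
      by_cases hi : i ∈ s
      · obtain ⟨ε, hε, hb⟩ := Metric.isOpen_iff.1 (hv i hi).1 (x i) (hv i hi).2
        exact ⟨ε, hε, fun _ => hb⟩
      · exact ⟨1, one_pos, fun hi' => absurd hi' hi⟩
    choose ε hε hball using hex
    refine ⟨(s : Set ι).pi fun i => Set.Ioc (x i - ε i / 2) (x i + ε i / 2),
      ⟨s, _, fun i _ => Or.inr ⟨_, _, by linarith [hε i], rfl⟩, rfl⟩, ?_, ?_⟩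
    · exact set_pi_mem_nhds s.finite_toSet fun i _ =>
        Ioc_mem_nhds (by linarith [hε i]) (by linarith [hε i])
    · refine subset_trans (Set.pi_mono fun i hi => ?_) hvu
      refine subset_trans (fun y hy => ?_) (hball i hi)
      rw [Metric.mem_ball, Real.dist_eq, abs_lt]
      constructor <;> linarith [hy.1, hy.2, hε i]
  · rintro _ ⟨s, t, ht, rfl⟩
    have := hbox s t (fun i => ht i trivial) ∅ 0
    simp only [Finset.notMem_empty, false_imp_iff, implies_true, Set.ofPred_true,
      Set.univ_inter] at this
    rw [← NNReal.tendsto_coe]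
    exact this

-- The product metric is a sum of coordinate distances capped at `2⁻¹ ^ encode i`, so a Lipschitz
-- test function only sees expected capped distances, one coordinate at a time.
open scoped PiCountable in
theorem edist_integral_comp_le_of_lipschitzWith {ι Ω : Type*} [Encodable ι] [MeasurableSpace Ω]
    {m : Measure Ω} [IsProbabilityMeasure m] {f : (ι → ℝ) → ℝ} {C : ℝ} {K : NNReal}
    (hC : ∀ x y, dist (f x) (f y) ≤ C) (hK : LipschitzWith K f)
    {A B : Ω → ι → ℝ} (hA : AEMeasurable A m) (hB : AEMeasurable B m) :
    edist (∫ ω, f (A ω) ∂m) (∫ ω, f (B ω) ∂m) ≤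
      K * ∑' i, ∫⁻ ω, min (2⁻¹ ^ Encodable.encode i) (edist (A ω i) (B ω i)) ∂m := by
  have hfm : Measurable f := hK.continuous.measurable
  have hint : ∀ {D : Ω → ι → ℝ}, AEMeasurable D m → Integrable (fun ω => f (D ω)) m := by
    intro D hD
    refine Integrable.of_bound (C := ‖f 0‖ + C) (hfm.comp_aemeasurable hD).aestronglyMeasurable
      (Eventually.of_forall fun ω => ?_)
    have h1 := hC (D ω) 0
    have h2 := norm_le_norm_add_norm_sub' (f (D ω)) (f 0)
    rw [dist_eq_norm] at h1
    linarith
  have hcoord : ∀ {D : Ω → ι → ℝ}, AEMeasurable D m → ∀ i, AEMeasurable (fun ω => D ω i) m :=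
    fun hD i => (measurable_pi_apply i).comp_aemeasurable hD
  calc edist (∫ ω, f (A ω) ∂m) (∫ ω, f (B ω) ∂m)
      = ‖∫ ω, (f (A ω) - f (B ω)) ∂m‖ₑ := by
        rw [edist_eq_enorm_sub, integral_sub (hint hA) (hint hB)]
    _ ≤ ∫⁻ ω, ‖f (A ω) - f (B ω)‖ₑ ∂m := enorm_integral_le_lintegral_enorm _
    _ ≤ ∫⁻ ω, K * ∑' i, min (2⁻¹ ^ Encodable.encode i) (edist (A ω i) (B ω i)) ∂m := by
        refine lintegral_mono fun ω => ?_
        rw [← edist_eq_enorm_sub]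
        exact hK (A ω) (B ω)
    _ = K * ∑' i, ∫⁻ ω, min (2⁻¹ ^ Encodable.encode i) (edist (A ω i) (B ω i)) ∂m := by
        rw [lintegral_const_mul' _ _ ENNReal.coe_ne_top, lintegral_tsum]
        exact fun i => aemeasurable_const.min ((hcoord hA i).edist (hcoord hB i))

/-- If the coordinates are close in probability, so are the sequences for the product metric. -/
theorem eventually_tsum_lintegral_min_le {ι κ σ : Type*} [Encodable ι]
    {Ω : κ → Type*} [∀ n, MeasurableSpace (Ω n)] {μ : ∀ n, Measure (Ω n)}
    [∀ n, IsProbabilityMeasure (μ n)] {l : Filter κ} {L : Filter σ}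
    {D : σ → ∀ n, Ω n → ι → ℝ≥0∞}
    (h : ∀ i, ∀ δ > 0, ∀ᶠ s in L, ∀ᶠ n in l, ∫⁻ ω, min 1 (D s n ω i) ∂μ n ≤ δ)
    {ε : ℝ≥0∞} (hε : 0 < ε) :
    ∀ᶠ s in L, ∀ᶠ n in l,
      ∑' i, ∫⁻ ω, min (2⁻¹ ^ Encodable.encode i) (D s n ω i) ∂μ n ≤ ε := by
  have h2 : ε / 2 ≠ 0 := (ENNReal.half_pos hε.ne').ne'
  -- Outside a finite `I` the geometric caps alone sum to less than `ε / 2`, whatever `s` and `n`.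
  obtain ⟨I, hI⟩ : ∃ I : Finset ι, ∑' i : {j // j ∉ I}, (2⁻¹ : ℝ≥0∞) ^ Encodable.encode (i : ι) <
      ε / 2 :=
    ((tendsto_order.1 <| ENNReal.tendsto_tsum_compl_atTop_zero
      (tsum_geometric_encode_lt_top ENNReal.one_half_lt_one).ne).2 _ (pos_iff_ne_zero.2 h2)).exists
  obtain ⟨δ, hδ, hδI⟩ : ∃ δ, 0 < δ ∧ δ * I.card < ε / 2 :=
    ENNReal.exists_pos_mul_lt (by simp) h2
  have hall : ∀ᶠ s in L, ∀ i ∈ I, ∀ᶠ n in l, ∫⁻ ω, min 1 (D s n ω i) ∂μ n ≤ δ :=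
    (eventually_all_finset I).2 fun i _ => h i δ hδ
  filter_upwards [hall] with s hs
  filter_upwards [(eventually_all_finset I).2 hs] with n hn
  calc ∑' i, ∫⁻ ω, min (2⁻¹ ^ Encodable.encode i) (D s n ω i) ∂μ n
      = ∑ i ∈ I, ∫⁻ ω, min (2⁻¹ ^ Encodable.encode i) (D s n ω i) ∂μ n +
        ∑' i : {j // j ∉ I}, ∫⁻ ω, min (2⁻¹ ^ Encodable.encode (i : ι)) (D s n ω i) ∂μ n :=
        (ENNReal.sum_add_tsum_compl _ _).symm
    _ ≤ ∑ i ∈ I, δ + ∑' i : {j // j ∉ I}, (2⁻¹ : ℝ≥0∞) ^ Encodable.encode (i : ι) := by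
        gcongr with i hi i
        · refine le_trans (lintegral_mono fun ω => ?_) (hn i hi)
          gcongr
          exact pow_le_one₀ zero_le (by simp)
        · refine le_trans (lintegral_mono fun ω => min_le_left _ _) ?_
          simp
    _ ≤ ε / 2 + ε / 2 := by
        gcongr
        simpa [mul_comm] using hδI.le
    _ = ε := ENNReal.add_halves ε

open scoped Topology PiCountable in
/-- Convergence in distribution in a countable product of lines, by approximation in probability
in each coordinate, uniformly along the sequence. -/
theorem tendstoInDistribution_pi_of_approx {ι κ σ Ω' : Type*} [Countable ι]
    {Ω : κ → Type*} [∀ n, MeasurableSpace (Ω n)] [MeasurableSpace Ω']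
    {μ : ∀ n, Measure (Ω n)} [∀ n, IsProbabilityMeasure (μ n)]
    {P : Measure Ω'} [IsProbabilityMeasure P] {l : Filter κ} [l.IsCountablyGenerated] [l.NeBot]
    {L : Filter σ} [L.NeBot]
    {X : ∀ n, Ω n → ι → ℝ} {Z : Ω' → ι → ℝ} {Y : σ → ∀ n, Ω n → ι → ℝ} {W : σ → Ω' → ι → ℝ}
    (hX : ∀ n, AEMeasurable (X n) (μ n)) (hZ : AEMeasurable Z P)
    (hYW : ∀ s, TendstoInDistribution (Y s) l (W s) μ P)
    (hXY : ∀ i, ∀ δ > 0, ∀ᶠ s in L, ∀ᶠ n in l,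
      ∫⁻ ω, min 1 (edist (X n ω i) (Y s n ω i)) ∂μ n ≤ δ)
    (hZW : ∀ i, ∀ δ > 0, ∀ᶠ s in L, ∫⁻ ω, min 1 (edist (Z ω i) (W s ω i)) ∂P ≤ δ) :
    TendstoInDistribution X l Z μ P := by
  classical
  refine ⟨hX, hZ, ?_⟩
  have : Encodable ι := Encodable.ofCountable ι
  refine tendsto_iff_forall_lipschitz_integral_tendsto.2 ?_
  rintro f ⟨C, hC⟩ ⟨K, hK⟩
  have hfc : Continuous f := hK.continuous
  simp only [ProbabilityMeasure.coe_mk]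
  rw [integral_map hZ hfc.aestronglyMeasurable]
  simp_rw [integral_map (hX _) hfc.aestronglyMeasurable]
  rw [EMetric.tendsto_nhds]
  intro ε hε
  obtain ⟨δ, hδ, hKδ⟩ : ∃ δ : ℝ≥0∞, 0 < δ ∧ δ * K < ε / 3 :=
    ENNReal.exists_pos_mul_lt (by simp) (ENNReal.div_pos hε.ne' (by simp)).ne'
  have h1 := eventually_tsum_lintegral_min_le (D := fun s n ω i => edist (X n ω i) (Y s n ω i))
    hXY hδ
  -- `Z` and `W s` are treated as families constant in `n`, so that the same lemma applies; the idle
  -- index is discarded below because `l` is nontrivial.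
  have h2 := eventually_tsum_lintegral_min_le (l := l) (μ := fun _ => P)
    (D := fun s (_ : κ) ω i => edist (Z ω i) (W s ω i))
    (fun i δ hδ => (hZW i δ hδ).mono fun s hs => Eventually.of_forall fun _ => hs) hδ
  obtain ⟨s, hs1, hs2⟩ := (h1.and h2).exists
  obtain ⟨-, hs2⟩ := hs2.exists
  have h3 := tendsto_iff_forall_lipschitz_integral_tendsto.1 (hYW s).tendsto f ⟨C, hC⟩ ⟨K, hK⟩
  simp only [ProbabilityMeasure.coe_mk] at h3
  rw [integral_map (hYW s).aemeasurable_limit hfc.aestronglyMeasurable] at h3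
  simp_rw [integral_map ((hYW s).forall_aemeasurable _) hfc.aestronglyMeasurable] at h3
  have h3' := EMetric.tendsto_nhds.1 h3 (ε / 3) (ENNReal.div_pos hε.ne' (by simp))
  filter_upwards [hs1, h3'] with n hn1 hn3
  calc edist (∫ ω, f (X n ω) ∂μ n) (∫ ω, f (Z ω) ∂P)
      ≤ edist (∫ ω, f (X n ω) ∂μ n) (∫ ω, f (Y s n ω) ∂μ n) +
        edist (∫ ω, f (Y s n ω) ∂μ n) (∫ ω, f (W s ω) ∂P) +
        edist (∫ ω, f (W s ω) ∂P) (∫ ω, f (Z ω) ∂P) := edist_triangle4 _ _ _ _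
    _ < ε / 3 + ε / 3 + ε / 3 := by
        refine ENNReal.add_lt_add (ENNReal.add_lt_add ?_ hn3) ?_
        · refine lt_of_le_of_lt (edist_integral_comp_le_of_lipschitzWith hC hK (hX n)
            ((hYW s).forall_aemeasurable n)) (lt_of_le_of_lt ?_ hKδ)
          rw [mul_comm]
          gcongr
        · rw [edist_comm]
          refine lt_of_le_of_lt (edist_integral_comp_le_of_lipschitzWith hC hK hZ
            (hYW s).aemeasurable_limit) (lt_of_le_of_lt ?_ hKδ)
          rw [mul_comm]
          gcongr
    _ = ε := ENNReal.add_thirds ε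

/-! ### Prime exponents of the least common multiple -/

theorem _root_.Nat.factorization_finset_lcm {ι : Type*} (s : Finset ι) (u : ι → ℕ)
    (hu : ∀ i ∈ s, u i ≠ 0) (p : ℕ) :
    (s.lcm u).factorization p = s.sup fun i => (u i).factorization p := by
  classical
  induction s using Finset.induction_on with
  | empty => simp
  | insert a s ha ih =>
    have h1 : u a ≠ 0 := hu a (Finset.mem_insert_self a s)
    have h2 : ∀ i ∈ s, u i ≠ 0 := fun i hi => hu i (Finset.mem_insert_of_mem hi)
    have h3 : s.lcm u ≠ 0 := fun h => by
      obtain ⟨i, hi, h0⟩ := Finset.lcm_eq_zero_iff.1 h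
      exact h2 i hi h0
    rw [Finset.lcm_insert, Finset.sup_insert, ← ih h2]
    change (Nat.lcm (u a) (s.lcm u)).factorization p = _
    rw [Nat.factorization_lcm h1 h3]
    rfl

theorem _root_.Real.hasSum_factorization_mul_log (N : ℕ) :
    HasSum (fun p : Nat.Primes => (N.factorization p : ℝ) * Real.log (p : ℝ)) (Real.log N) := by
  have h0 : HasSum (fun p : ℕ => (N.factorization p : ℝ) * Real.log (p : ℝ)) (Real.log N) := by
    rw [Real.log_nat_eq_sum_factorization, Finsupp.sum]
    refine hasSum_sum_of_ne_finset_zero fun p hp => ?_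
    simp [Finsupp.notMem_support_iff.1 hp]
  refine (hasSum_subtype_iff_of_support_subset (s := {p : ℕ | p.Prime}) ?_).2 h0
  intro p hp
  by_contra hnp
  exact hp (by simp [Nat.factorization_eq_zero_of_not_prime N hnp])

namespace RandomLcm

/-- Seeing `m` values takes at least `m` draws, and distinct draws attain this bound. -/
theorem couponTime_eq_of_injOn {n m : ℕ} {u : ℕ → ℕ} (hmn : m ≤ n)
    (hu : Set.InjOn u (Finset.range m)) : couponTime n m u = m := by
  have hmem : m ∈ {j : ℕ | (values u j).card = min m n} := by
    simp [values, Finset.card_image_of_injOn hu, hmn]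
  refine le_antisymm (Nat.sInf_le hmem) ?_
  have h := Nat.sInf_mem ⟨m, hmem⟩
  simp only [Set.mem_ofPred_eq, min_eq_left hmn] at h
  have h' : (values u (couponTime n m u)).card = m := by simpa [couponTime, hmn] using h
  calc m = (values u (couponTime n m u)).card := h'.symm
    _ ≤ (Finset.range (couponTime n m u)).card := Finset.card_image_le
    _ = couponTime n m u := Finset.card_range _

theorem hasSum_limitTerm_factorization {m : ℕ} {u : ℕ → ℕ} (hu : ∀ k < m, u k ≠ 0) :
    HasSum (limitTerm m fun k p => (u k).factorization p)
      (Real.log (((Finset.range m).lcm u : ℕ) : ℝ) - ∑ k ∈ Finset.range m, Real.log (u k)) := by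
  have h := (Real.hasSum_factorization_mul_log ((Finset.range m).lcm u)).sub
    (hasSum_sum (s := Finset.range m) fun k _ => Real.hasSum_factorization_mul_log (u k))
  refine Eq.subst (motive := fun f => HasSum f _) (funext fun p => ?_) h
  rw [limitTerm, Nat.factorization_finset_lcm _ _ (fun i hi => hu i (Finset.mem_range.1 hi)),
    ← Finset.sum_mul]
  ring

/-- Without repetitions there is no approximation error: adding and subtracting `∑ log (u k)` splits
the logarithm of the lcm into sizes and a sum over primes. -/
theorem logLcmCentered_eq_limitValue {n m : ℕ} {u : ℕ → ℕ} (hn : n ≠ 0) (hmn : m ≤ n)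
    (hinj : Set.InjOn u (Finset.range m)) (hu : ∀ k < m, u k ≠ 0) :
    logLcmCentered n m u =
      limitValue m (fun j => (u j : ℝ) / n) fun k p => (u k).factorization p := by
  rw [logLcmCentered, limitValue, (hasSum_limitTerm_factorization hu).tsum_eq, randomSubset,
    couponTime_eq_of_injOn hmn hinj, values, Finset.lcm_image, Function.id_comp]
  have : ∀ j ∈ Finset.range m, Real.log ((u j : ℝ) / n) = Real.log (u j) - Real.log n := fun j hj =>
    Real.log_div (Nat.cast_ne_zero.2 (hu j (Finset.mem_range.1 hj))) (Nat.cast_ne_zero.2 hn)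
  rw [Finset.sum_congr rfl this, Finset.sum_sub_distrib]
  simp

/-- If `a k` is maximal, every other term equals `min (a k) (a j)`, so the row `i = k` of the double
sum already accounts for the excess over the maximum. -/
theorem sum_le_sup_add_sum_min (m : ℕ) (a : ℕ → ℕ) :
    ∑ k ∈ Finset.range m, a k ≤ (Finset.range m).sup a +
      ∑ i ∈ Finset.range m, ∑ j ∈ (Finset.range m).erase i, min (a i) (a j) := by
  rcases Nat.eq_zero_or_pos m with rfl | hm
  · simp
  obtain ⟨k, hk, hsup⟩ := Finset.exists_mem_eq_sup (Finset.range m) ⟨0, Finset.mem_range.2 hm⟩ a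
  have hle : ∀ j ∈ Finset.range m, a j ≤ a k := fun j hj => hsup ▸ Finset.le_sup hj
  rw [hsup, ← Finset.add_sum_erase _ _ hk]
  gcongr
  calc ∑ j ∈ (Finset.range m).erase k, a j
      = ∑ j ∈ (Finset.range m).erase k, min (a k) (a j) :=
        Finset.sum_congr rfl fun j hj => (min_eq_right (hle j (Finset.mem_of_mem_erase hj))).symm
    _ ≤ _ := Finset.single_le_sum
        (f := fun i => ∑ j ∈ (Finset.range m).erase i, min (a i) (a j)) (fun _ _ => zero_le) hk

theorem abs_limitTerm_le (m : ℕ) (g : ℕ → Nat.Primes → ℕ) (p : Nat.Primes) :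
    |limitTerm m g p| ≤ Real.log p *
      ∑ i ∈ Finset.range m, ∑ j ∈ (Finset.range m).erase i, ((min (g i p) (g j p) : ℕ) : ℝ) := by
  have hlog : 0 ≤ Real.log (p : ℝ) := Real.log_natCast_nonneg p
  have h1 : ((Finset.range m).sup fun k => g k p) ≤ ∑ k ∈ Finset.range m, g k p :=
    Finset.sup_le fun k hk => Finset.single_le_sum (f := fun k => g k p) (fun _ _ => zero_le) hk
  have h2 := sum_le_sup_add_sum_min m fun k => g k p
  have h1' : (((Finset.range m).sup fun k => g k p : ℕ) : ℝ) ≤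
      ∑ k ∈ Finset.range m, (g k p : ℝ) := by exact_mod_cast h1
  have h2' : ∑ k ∈ Finset.range m, (g k p : ℝ) ≤ (((Finset.range m).sup fun k => g k p : ℕ) : ℝ) +
      ∑ i ∈ Finset.range m, ∑ j ∈ (Finset.range m).erase i, ((min (g i p) (g j p) : ℕ) : ℝ) := by
    exact_mod_cast h2
  rw [limitTerm, abs_mul, abs_of_nonneg hlog, abs_of_nonpos (by linarith)]
  gcongr
  linarith

/-! ### Measurability -/

/-- Such an `F` factors through `Fin j → α`, a countable discrete space on which every map is
measurable. -/
theorem measurable_of_forall_eq_of_lt {α β : Type*} [MeasurableSpace α] [Countable α] [Inhabited α]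
    [MeasurableSingletonClass α] [MeasurableSpace β] {F : (ℕ → α) → β} (j : ℕ)
    (hF : ∀ u v : ℕ → α, (∀ i < j, u i = v i) → F u = F v) : Measurable F := by
  let E : (Fin j → α) → ℕ → α := fun w i => if h : i < j then w ⟨i, h⟩ else default
  have hFE : F = (F ∘ E) ∘ fun u (i : Fin j) => u i := by
    funext u
    exact hF _ _ fun i hi => by simp [E, hi]
  rw [hFE]
  exact (Measurable.of_discrete).comp (measurable_pi_lambda _ fun i => measurable_pi_apply _)

theorem values_congr {u v : ℕ → ℕ} {j : ℕ} (h : ∀ i < j, u i = v i) : values u j = values v j :=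
  Finset.image_congr fun i hi => h i (Finset.mem_range.1 hi)

theorem measurable_couponTime (n m : ℕ) : Measurable (couponTime n m) := by
  have hA : ∀ j, MeasurableSet {u : ℕ → ℕ | (values u j).card = min m n} := fun j =>
    measurableSet_eq_fun (f := fun u : ℕ → ℕ => (values u j).card)
      (measurable_of_forall_eq_of_lt j fun u v h => by rw [values_congr h]) measurable_const
  refine measurable_to_countable' fun k => ?_
  -- The second piece is the event that the required cardinality is never reached, where `sInf ∅ =
  -- 0`.
  have hset : couponTime n m ⁻¹' {k} =
      ({u | (values u k).card = min m n} ∩ ⋂ j ∈ Finset.range k, {u | (values u j).card = min m n}ᶜ)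
        ∪ (if k = 0 then ⋂ j, {u | (values u j).card = min m n}ᶜ else ∅) := by
    ext u
    simp only [Set.mem_preimage, Set.mem_singleton_iff, Set.mem_union, Set.mem_inter_iff,
      Set.mem_iInter, Set.mem_compl_iff, Set.mem_ofPred_eq, Finset.mem_range, couponTime]
    constructor
    · rintro rfl
      by_cases hne : {j : ℕ | (values u j).card = min m n}.Nonempty
      · exact Or.inl ⟨Nat.sInf_mem hne, fun j hj =>
          show j ∉ {j : ℕ | (values u j).card = min m n} from Nat.notMem_of_lt_sInf hj⟩
      · refine Or.inr ?_
        rw [Set.not_nonempty_iff_eq_empty] at hne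
        rw [hne]
        simpa [Set.eq_empty_iff_forall_notMem] using hne
    · rintro (⟨h1, h2⟩ | h)
      · refine le_antisymm (Nat.sInf_le h1) (le_of_not_gt fun hlt => ?_)
        exact h2 _ hlt (Nat.sInf_mem (s := {j : ℕ | (values u j).card = min m n}) ⟨k, h1⟩)
      · split_ifs at h with hk
        · have : {j : ℕ | (values u j).card = min m n} = ∅ := by
            simpa [Set.eq_empty_iff_forall_notMem] using h
          rw [this, hk, Nat.sInf_empty]
        · exact h.elim
  rw [hset]
  refine ((hA k).inter (Finset.measurableSet_biInter _ fun j _ => (hA j).compl)).union ?_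
  split_ifs
  · exact MeasurableSet.iInter fun j => (hA j).compl
  · exact MeasurableSet.empty

theorem measurable_logLcmCentered (n m : ℕ) : Measurable (logLcmCentered n m) := by
  have h : Measurable fun q : ℕ × (ℕ → ℕ) => Real.log (((values q.2 q.1).lcm id : ℕ) : ℝ) :=
    measurable_from_prod_countable_right fun j =>
      measurable_of_forall_eq_of_lt j fun u v huv => by simp only [values_congr huv]
  exact (h.comp ((measurable_couponTime n m).prodMk measurable_id)).sub_const _

theorem measurable_limitTerm {m : ℕ} {Ω : Type*} [MeasurableSpace Ω] {g : ℕ → Nat.Primes → Ω → ℕ}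
    (hg : ∀ k p, Measurable (g k p)) (p : Nat.Primes) :
    Measurable fun ω => limitTerm m (fun k p => g k p ω) p := by
  have h : Measurable fun a : ℕ → ℕ => Real.log (p : ℝ) *
      ((((Finset.range m).sup a : ℕ) : ℝ) - ∑ k ∈ Finset.range m, (a k : ℝ)) :=
    measurable_of_forall_eq_of_lt m fun a b hab => by
      rw [Finset.sup_congr rfl fun i hi => hab i (Finset.mem_range.1 hi),
        Finset.sum_congr rfl fun i hi => by rw [hab i (Finset.mem_range.1 hi)]]
  exact h.comp (measurable_pi_lambda _ fun k => hg k p)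

theorem measurable_limitValue {m : ℕ} {Ω : Type*} [MeasurableSpace Ω] {v : ℕ → Ω → ℝ}
    {g : ℕ → Nat.Primes → Ω → ℕ} (hv : ∀ j, Measurable (v j)) (hg : ∀ k p, Measurable (g k p)) :
    Measurable fun ω => limitValue m (fun j => v j ω) fun k p => g k p ω :=
  (Finset.measurable_sum _ fun j _ => (hv j).log).add
    (Measurable.tsum fun p => measurable_limitTerm hg p)

end RandomLcm

/-! ### First moments and truncation to finitely many primes -/

namespace RandomLcm

/-- The truncation of `limitValue` to the primes in a finite set. -/
noncomputable def truncatedValue (S : Finset Nat.Primes) (m : ℕ) (v : ℕ → ℝ) (g : ℕ → Nat.Primes → ℕ) : ℝ :=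
  ∑ j ∈ Finset.range m, Real.log (v j) + ∑ p ∈ S, limitTerm m g p

/-- A bound for the first absolute moment of `limitTerm m g p`. -/
noncomputable def momentBound (m : ℕ) (p : Nat.Primes) : ℝ≥0∞ :=
  ENNReal.ofReal (Real.log p) * (m * m * (2 * (((p : ℕ) : ℝ≥0∞) ^ 2)⁻¹))

theorem tsum_momentBound_ne_top (m : ℕ) : ∑' p, momentBound m p ≠ ∞ := by
  -- The inequality `log p ≤ 2 p ^ (1/2)` turns `2 m² log p / p²` into `4 m² p ^ (-3/2)`.
  have hs : Summable fun p : Nat.Primes => (4 * (m : ℝ) * m) * ((p : ℕ) : ℝ) ^ (-(3 / 2) : ℝ) :=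
    (Nat.Primes.summable_rpow.2 (by norm_num)).mul_left _
  refine ne_top_of_le_ne_top hs.tsum_ofReal_ne_top (ENNReal.tsum_le_tsum fun p => ?_)
  have hp : (0 : ℝ) < ((p : ℕ) : ℝ) := Nat.cast_pos.2 p.2.pos
  have hlog : 0 ≤ Real.log (p : ℝ) := Real.log_natCast_nonneg p
  have h1 : momentBound m p =
      ENNReal.ofReal (Real.log p * (m * m * (2 * (((p : ℕ) : ℝ) ^ 2)⁻¹))) := by
    rw [momentBound, ENNReal.ofReal_mul hlog, ENNReal.ofReal_mul (by positivity),
      ENNReal.ofReal_mul (by positivity), ENNReal.ofReal_mul (by positivity),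
      ENNReal.ofReal_inv_of_pos (by positivity), ENNReal.ofReal_pow hp.le]
    simp
  rw [h1]
  refine ENNReal.ofReal_le_ofReal ?_
  have h2 := Real.log_le_rpow_div hp.le (one_half_pos (α := ℝ))
  have h3 : ((p : ℕ) : ℝ) ^ (-(3 / 2) : ℝ) = ((p : ℕ) : ℝ) ^ (1 / 2 : ℝ) * (((p : ℕ) : ℝ) ^ 2)⁻¹ := by
    rw [← Real.rpow_natCast, ← Real.rpow_neg hp.le, ← Real.rpow_add hp]
    norm_num
  rw [h3]
  calc Real.log p * (m * m * (2 * (((p : ℕ) : ℝ) ^ 2)⁻¹))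
      ≤ (((p : ℕ) : ℝ) ^ (1 / 2 : ℝ) / (1 / 2)) * (m * m * (2 * (((p : ℕ) : ℝ) ^ 2)⁻¹)) := by gcongr
    _ = _ := by ring

section Moments

variable {Ω : Type*} [MeasurableSpace Ω] {μ : Measure Ω}

theorem lintegral_natCast_eq_tsum {N : Ω → ℕ} (hN : Measurable N) :
    ∫⁻ ω, (N ω : ℝ≥0∞) ∂μ = ∑' a : ℕ, μ {ω | a + 1 ≤ N ω} := by
  have hm : ∀ a : ℕ, MeasurableSet {ω | a + 1 ≤ N ω} := fun a => measurableSet_le measurable_const hN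
  have h : ∀ ω, (N ω : ℝ≥0∞) = ∑' a : ℕ, {ω | a + 1 ≤ N ω}.indicator (fun _ => (1 : ℝ≥0∞)) ω := by
    intro ω
    rw [tsum_eq_sum (s := Finset.range (N ω))]
    · rw [Finset.sum_congr rfl (g := fun _ => (1 : ℝ≥0∞))]
      · simp
      · intro a ha
        exact Set.indicator_of_mem (s := {ω | a + 1 ≤ N ω}) (Nat.succ_le_of_lt (Finset.mem_range.1 ha)) _
    · intro a ha
      exact Set.indicator_of_notMem (s := {ω | a + 1 ≤ N ω})
        (fun h => ha (Finset.mem_range.2 (Nat.lt_of_succ_le h))) _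
  simp_rw [h]
  rw [lintegral_tsum fun a => (measurable_const.indicator (hm a)).aemeasurable]
  exact tsum_congr fun a => by rw [lintegral_indicator_const (hm a), one_mul]

variable {g : ℕ → Nat.Primes → Ω → ℕ}

/-- The tail sum is at most a geometric series starting at its ratio `r = p⁻² ≤ 1/2`, hence at most
`r / (1 - r) ≤ 2 r`. Assuming only an upper bound covers both the geometric variables and the
exponents of uniform samples. -/
theorem lintegral_min_le (hg : ∀ k p, Measurable (g k p)) {i j : ℕ} {p : Nat.Primes}
    (h : ∀ a : ℕ, μ {ω | a ≤ g i p ω ∧ a ≤ g j p ω} ≤ ((((p : ℕ) : ℝ≥0∞) ^ a)⁻¹) ^ 2) :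
    ∫⁻ ω, ((min (g i p ω) (g j p ω) : ℕ) : ℝ≥0∞) ∂μ ≤ 2 * (((p : ℕ) : ℝ≥0∞) ^ 2)⁻¹ := by
  rw [lintegral_natCast_eq_tsum ((hg i p).min (hg j p))]
  set r : ℝ≥0∞ := (((p : ℕ) : ℝ≥0∞) ^ 2)⁻¹ with hr
  have hr2 : r ≤ 2⁻¹ := by
    rw [hr]
    refine ENNReal.inv_le_inv.2 ?_
    have : 2 ≤ (p : ℕ) ^ 2 := le_trans p.2.two_le (Nat.le_self_pow two_ne_zero _)
    exact_mod_cast this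
  calc ∑' a : ℕ, μ {ω | a + 1 ≤ min (g i p ω) (g j p ω)}
      ≤ ∑' a : ℕ, r * r ^ a := by
        refine ENNReal.tsum_le_tsum fun a => ?_
        simp only [le_min_iff]
        refine (h (a + 1)).trans_eq ?_
        rw [hr, ← pow_succ', ← ENNReal.inv_pow, ← ENNReal.inv_pow, ← pow_mul, ← pow_mul, mul_comm]
    _ = r * (1 - r)⁻¹ := by rw [ENNReal.tsum_mul_left, ENNReal.tsum_geometric]
    _ ≤ r * 2 := by
        gcongr
        rw [ENNReal.inv_le_iff_inv_le]
        refine ENNReal.le_sub_of_add_le_left (ne_top_of_le_ne_top (by simp) hr2) ?_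
        calc r + 2⁻¹ ≤ 2⁻¹ + 2⁻¹ := by gcongr
          _ = 1 := ENNReal.inv_two_add_inv_two
    _ = 2 * r := mul_comm _ _

theorem lintegral_enorm_limitTerm_le (hg : ∀ k p, Measurable (g k p))
    (h : ∀ i j, i ≠ j → ∀ (p : Nat.Primes) (a : ℕ),
      μ {ω | a ≤ g i p ω ∧ a ≤ g j p ω} ≤ ((((p : ℕ) : ℝ≥0∞) ^ a)⁻¹) ^ 2) (m : ℕ) (p : Nat.Primes) :
    ∫⁻ ω, ‖limitTerm m (fun k p => g k p ω) p‖ₑ ∂μ ≤ momentBound m p := by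
  have hmm : ∀ i j, Measurable fun ω => ((min (g i p ω) (g j p ω) : ℕ) : ℝ≥0∞) := fun i j =>
    Measurable.of_discrete.comp ((hg i p).min (hg j p))
  calc ∫⁻ ω, ‖limitTerm m (fun k p => g k p ω) p‖ₑ ∂μ
      ≤ ∫⁻ ω, ENNReal.ofReal (Real.log p) * ∑ i ∈ Finset.range m, ∑ j ∈ (Finset.range m).erase i,
          ((min (g i p ω) (g j p ω) : ℕ) : ℝ≥0∞) ∂μ := by
        refine lintegral_mono fun ω => ?_
        rw [Real.enorm_eq_ofReal_abs]
        refine (ENNReal.ofReal_le_ofReal (abs_limitTerm_le m _ p)).trans_eq ?_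
        rw [ENNReal.ofReal_mul (Real.log_natCast_nonneg p)]
        congr 1
        simp_rw [← Nat.cast_sum]
        rw [ENNReal.ofReal_natCast]
    _ = ENNReal.ofReal (Real.log p) * ∑ i ∈ Finset.range m, ∑ j ∈ (Finset.range m).erase i,
          ∫⁻ ω, ((min (g i p ω) (g j p ω) : ℕ) : ℝ≥0∞) ∂μ := by
        rw [lintegral_const_mul' _ _ ENNReal.ofReal_ne_top, lintegral_finsetSum]
        · congr 1
          exact Finset.sum_congr rfl fun i _ => lintegral_finsetSum _ fun j _ => hmm i j
        · exact fun i _ => Finset.measurable_sum _ fun j _ => hmm i j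
    _ ≤ ENNReal.ofReal (Real.log p) * ∑ i ∈ Finset.range m, ∑ j ∈ Finset.range m,
          (2 * (((p : ℕ) : ℝ≥0∞) ^ 2)⁻¹) := by
        gcongr with i hi
        refine le_trans (Finset.sum_le_sum fun j hj => lintegral_min_le hg
          (h i j (Finset.ne_of_mem_erase hj).symm p)) ?_
        exact Finset.sum_le_sum_of_subset (Finset.erase_subset _ _)
    _ = momentBound m p := by
        simp [momentBound, mul_assoc]

theorem ae_summable_limitTerm (hg : ∀ k p, Measurable (g k p))
    (h : ∀ i j, i ≠ j → ∀ (p : Nat.Primes) (a : ℕ),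
      μ {ω | a ≤ g i p ω ∧ a ≤ g j p ω} ≤ ((((p : ℕ) : ℝ≥0∞) ^ a)⁻¹) ^ 2) (m : ℕ) :
    ∀ᵐ ω ∂μ, Summable (limitTerm m fun k p => g k p ω) := by
  have hm : ∀ p, AEMeasurable (fun ω => ‖limitTerm m (fun k p => g k p ω) p‖ₑ) μ := fun p =>
    (measurable_limitTerm hg p).enorm.aemeasurable
  have hfin : ∫⁻ ω, ∑' p, ‖limitTerm m (fun k p => g k p ω) p‖ₑ ∂μ ≠ ∞ := by
    rw [lintegral_tsum hm]
    exact ne_top_of_le_ne_top (tsum_momentBound_ne_top m)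
      (ENNReal.tsum_le_tsum fun p => lintegral_enorm_limitTerm_le hg h m p)
  filter_upwards [ae_lt_top' (AEMeasurable.tsum hm) hfin] with ω hω
  refine Summable.of_norm ?_
  refine (ENNReal.tsum_coe_ne_top_iff_summable.1 hω.ne).map NNReal.toRealHom NNReal.continuous_coe

/-- The logarithms of `v` cancel and only primes outside `S` remain. The bound involves neither `v`
nor the law of `g`, so it will be uniform in the sample size. -/
theorem lintegral_edist_limitValue_truncatedValue_le (hg : ∀ k p, Measurable (g k p))
    (h : ∀ i j, i ≠ j → ∀ (p : Nat.Primes) (a : ℕ),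
      μ {ω | a ≤ g i p ω ∧ a ≤ g j p ω} ≤ ((((p : ℕ) : ℝ≥0∞) ^ a)⁻¹) ^ 2)
    (v : ℕ → Ω → ℝ) (m : ℕ) (S : Finset Nat.Primes) :
    ∫⁻ ω, edist (limitValue m (fun j => v j ω) fun k p => g k p ω)
        (truncatedValue S m (fun j => v j ω) fun k p => g k p ω) ∂μ ≤
      ∑' p : {p // p ∉ S}, momentBound m p := by
  calc ∫⁻ ω, edist (limitValue m (fun j => v j ω) fun k p => g k p ω)
        (truncatedValue S m (fun j => v j ω) fun k p => g k p ω) ∂μ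
      ≤ ∫⁻ ω, ∑' p : {p // p ∉ S}, ‖limitTerm m (fun k p => g k p ω) p‖ₑ ∂μ := by
        refine lintegral_mono_ae ?_
        filter_upwards [ae_summable_limitTerm hg h m] with ω hω
        rw [limitValue, truncatedValue, edist_add_left, ← hω.sum_add_tsum_compl (s := S),
          edist_eq_enorm_sub, add_sub_cancel_left]
        exact enorm_tsum_le_tsum_enorm
    _ = ∑' p : {p // p ∉ S}, ∫⁻ ω, ‖limitTerm m (fun k p => g k p ω) p‖ₑ ∂μ :=
        lintegral_tsum fun p => (measurable_limitTerm hg _).enorm.aemeasurable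
    _ ≤ _ := ENNReal.tsum_le_tsum fun p => lintegral_enorm_limitTerm_le hg h m p

end Moments

end RandomLcm

/-! ### Joint convergence of sizes and prime exponents -/

open scoped Topology in
/-- Random sequences whose finite dimensional lower orthant probabilities converge, converge in
distribution. -/
theorem tendstoInDistribution_pi_of_tendsto_orthant {ι κ Ω' : Type*} [Countable ι]
    {Ω : κ → Type*} [∀ n, MeasurableSpace (Ω n)] [MeasurableSpace Ω']
    {μ : ∀ n, Measure (Ω n)} [∀ n, IsProbabilityMeasure (μ n)]
    {P : Measure Ω'} [IsProbabilityMeasure P] {l : Filter κ} [l.IsCountablyGenerated]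
    {X : ∀ n, Ω n → ι → ℝ} {Z : Ω' → ι → ℝ} (hX : ∀ n, Measurable (X n)) (hZ : Measurable Z)
    (h : ∀ (T : Finset ι) (x : ι → ℝ),
      Tendsto (fun n => (μ n).real {ω | ∀ i ∈ T, X n ω i ≤ x i}) l
        (𝓝 (P.real {ω | ∀ i ∈ T, Z ω i ≤ x i}))) :
    TendstoInDistribution X l Z μ P := by
  refine ⟨fun n => (hX n).aemeasurable, hZ.aemeasurable, ?_⟩
  refine tendsto_probabilityMeasure_pi_of_tendsto_orthant fun T x => ?_
  have hT : MeasurableSet {w : ι → ℝ | ∀ i ∈ T, w i ≤ x i} := by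
    have : {w : ι → ℝ | ∀ i ∈ T, w i ≤ x i} = ⋂ i ∈ T, {w | w i ≤ x i} := by
      ext w; simp
    rw [this]
    exact Finset.measurableSet_biInter _ fun i _ =>
      measurableSet_le (measurable_pi_apply i) measurable_const
  simp only [ProbabilityMeasure.coe_mk]
  rw [map_measureReal_apply hZ hT]
  simp_rw [map_measureReal_apply (hX _) hT]
  exact h T x

namespace RandomLcm

section Uniform

variable {Ω : Type*} [MeasurableSpace Ω] {μ : Measure Ω} {n : ℕ} {U : Ω → ℕ}

theorem measure_uniform_mem_finset (hU : Measurable U)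
    (hlaw : ∀ k ∈ Finset.Icc 1 n, μ {ω | U ω = k} = (n : ℝ≥0∞)⁻¹) {F : Finset ℕ}
    (hF : F ⊆ Finset.Icc 1 n) : μ {ω | U ω ∈ F} = F.card * (n : ℝ≥0∞)⁻¹ := by
  have hset : {ω | U ω ∈ F} = ⋃ k ∈ F, {ω | U ω = k} := by
    ext ω; simp
  rw [hset, measure_biUnion_finset]
  · rw [Finset.sum_congr rfl fun k hk => hlaw k (hF hk)]
    simp
  · intro i _ j _ hij
    exact Set.disjoint_left.2 fun ω hi hj => hij (hi.symm.trans hj)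
  · exact fun k _ => measurableSet_eq_fun hU measurable_const

variable [IsProbabilityMeasure μ]

theorem ae_uniform_mem_Icc (hn : n ≠ 0) (hU : Measurable U)
    (hlaw : ∀ k ∈ Finset.Icc 1 n, μ {ω | U ω = k} = (n : ℝ≥0∞)⁻¹) :
    ∀ᵐ ω ∂μ, U ω ∈ Finset.Icc 1 n := by
  have h := measure_uniform_mem_finset hU hlaw (Finset.Subset.refl _)
  rw [Nat.card_Icc, Nat.add_sub_cancel,
    ENNReal.mul_inv_cancel (by exact_mod_cast hn) (ENNReal.natCast_ne_top n)] at h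
  exact (prob_compl_eq_zero_iff (hU (Finset.measurableSet (Finset.Icc 1 n)))).2 h

theorem measure_uniform_mem (hn : n ≠ 0) (hU : Measurable U)
    (hlaw : ∀ k ∈ Finset.Icc 1 n, μ {ω | U ω = k} = (n : ℝ≥0∞)⁻¹) (D : Set ℕ)
    [DecidablePred (· ∈ D)] :
    μ (U ⁻¹' D) = ((Finset.Icc 1 n).filter (· ∈ D)).card * (n : ℝ≥0∞)⁻¹ := by
  rw [← measure_uniform_mem_finset hU hlaw (Finset.filter_subset _ _)]
  refine measure_congr ?_
  filter_upwards [ae_uniform_mem_Icc hn hU hlaw] with ω hω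
  refine propext ?_
  change U ω ∈ D ↔ U ω ∈ Finset.filter _ _
  rw [Finset.mem_filter]
  exact ⟨fun h => ⟨hω, h⟩, fun h => h.2⟩

theorem card_filter_dvd_le {t : ℝ} (ht0 : 0 ≤ t) (ht1 : t ≤ 1) (n Q : ℕ) :
    ((Finset.Icc 1 n).filter fun u : ℕ => (u : ℝ) ≤ t * n ∧ Q ∣ u).card = ⌊t * n⌋₊ / Q := by
  rw [← Nat.Ioc_filter_dvd_card_eq_div]
  congr 1
  ext u
  have h0 : 0 ≤ t * (n : ℝ) := by positivity
  simp only [Finset.mem_filter, Finset.mem_Icc, Finset.mem_Ioc, Nat.le_floor_iff h0]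
  constructor
  · rintro ⟨⟨h1, h2⟩, h3, h4⟩
    exact ⟨⟨h1, h3⟩, h4⟩
  · rintro ⟨⟨h1, h3⟩, h4⟩
    refine ⟨⟨h1, ?_⟩, h3, h4⟩
    have : (u : ℝ) ≤ n := h3.trans (mul_le_of_le_one_left (Nat.cast_nonneg n) ht1)
    exact_mod_cast this

open scoped Topology in
-- The nested floors collapse: `⌊t n⌋ / Q = ⌊(t / Q) n⌋`.
theorem tendsto_floor_div_div {t : ℝ} (ht0 : 0 ≤ t) (Q : ℕ) :
    Tendsto (fun n : ℕ => ((⌊t * n⌋₊ / Q : ℕ) : ℝ) * (n : ℝ)⁻¹) atTop (𝓝 (t / Q)) := by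
  have h := (tendsto_nat_floor_mul_div_atTop (a := t / Q) (by positivity)).comp
    (tendsto_natCast_atTop_atTop (R := ℝ))
  refine h.congr fun n => ?_
  simp only [Function.comp]
  rw [div_mul_eq_mul_div, Nat.floor_div_natCast, div_eq_mul_inv]

/-- There are `⌊n / p ^ a⌋` multiples of `p ^ a` up to `n`; the floor only lowers the probability,
so the bound has no error term and holds for every `n`. -/
theorem measure_uniform_le_factorization (hn : n ≠ 0) (hU : Measurable U)
    (hlaw : ∀ k ∈ Finset.Icc 1 n, μ {ω | U ω = k} = (n : ℝ≥0∞)⁻¹) (p : Nat.Primes) (a : ℕ) :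
    μ {ω | a ≤ (U ω).factorization p} ≤ (((p : ℕ) : ℝ≥0∞) ^ a)⁻¹ := by
  classical
  have hcard : ((Finset.Icc 1 n).filter (· ∈ {u : ℕ | a ≤ u.factorization p})).card =
      n / (p : ℕ) ^ a := by
    rw [← Nat.Ioc_filter_dvd_card_eq_div]
    congr 1
    ext u
    simp only [Finset.mem_filter, Finset.mem_Icc, Finset.mem_Ioc, Set.mem_ofPred_eq]
    refine and_congr_right fun hu => ?_
    rw [p.2.pow_dvd_iff_le_factorization (by lia)]
  refine (measure_uniform_mem hn hU hlaw {u : ℕ | a ≤ u.factorization p}).trans_le ?_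
  rw [hcard]
  have hp : (0 : ℝ≥0∞) < (((p : ℕ) ^ a : ℕ) : ℝ≥0∞) := by
    exact_mod_cast pow_pos p.2.pos a
  have hn' : (n : ℝ≥0∞) ≠ 0 := by exact_mod_cast hn
  rw [← div_eq_mul_inv]
  refine ENNReal.div_le_of_le_mul ?_
  rw [mul_comm, ← div_eq_mul_inv, ENNReal.le_div_iff_mul_le (Or.inl (by simpa using hp.ne'))
    (Or.inl (by simp))]
  exact_mod_cast Nat.div_mul_le_self n _

end Uniform

/-- The logarithms of the terms of a sequence and the opposites of the exponents of the primes,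
as a single family of real numbers. -/
noncomputable def logExponents (v : ℕ → ℝ) (g : ℕ → Nat.Primes → ℕ) : ℕ × Option Nat.Primes → ℝ
  | (j, none) => Real.log (v j)
  | (j, some p) => -(g j p : ℝ)

/-- The sign of the exponents turns upper bounds on coordinates into `a ≤ g`, that is, divisibility
conditions, which can be counted exactly. -/
theorem exists_logExponents_orthant_iff (T : Finset (ℕ × Option Nat.Primes))
    (x : ℕ × Option Nat.Primes → ℝ) :
    ∃ (J : Finset ℕ) (S : Finset Nat.Primes) (t : ℕ → ℝ) (a : ℕ → Nat.Primes → ℕ),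
      (∀ j, 0 ≤ t j ∧ t j ≤ 1) ∧ ∀ (v : ℕ → ℝ) (g : ℕ → Nat.Primes → ℕ),
        (∀ j, 0 < v j ∧ v j ≤ 1) →
          ((∀ q ∈ T, logExponents v g q ≤ x q) ↔
            ∀ j ∈ J, v j ≤ t j ∧ ∀ p ∈ S, a j p ≤ g j p) := by
  classical
  -- Coordinates outside `T` receive the vacuous thresholds `1` and `0`. Capping the exponential at
  -- `1` loses nothing since `v j ≤ 1`.
  refine ⟨T.image Prod.fst, (T.image Prod.snd).eraseNone,
    fun j => if (j, none) ∈ T then min 1 (Real.exp (x (j, none))) else 1,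
    fun j p => if (j, some p) ∈ T then ⌈-x (j, some p)⌉₊ else 0, fun j => ?_, fun v g hv => ?_⟩
  · dsimp only
    split_ifs
    · exact ⟨le_min zero_le_one (Real.exp_pos _).le, min_le_left _ _⟩
    · exact ⟨zero_le_one, le_rfl⟩
  have hnone : ∀ j, (j, none) ∈ T → (logExponents v g (j, none) ≤ x (j, none) ↔
      v j ≤ min 1 (Real.exp (x (j, none)))) := fun j _ => by
    rw [logExponents, Real.log_le_iff_le_exp (hv j).1, le_min_iff, and_iff_right (hv j).2]
  have hsome : ∀ j p, (logExponents v g (j, some p) ≤ x (j, some p) ↔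
      ⌈-x (j, some p)⌉₊ ≤ g j p) := fun j p => by
    rw [logExponents, Nat.ceil_le, neg_le]
  constructor
  · refine fun h j _ => ⟨?_, fun p _ => ?_⟩
    · dsimp only
      split_ifs with hj
      · exact (hnone j hj).1 (h _ hj)
      · exact (hv j).2
    · dsimp only
      split_ifs with hj
      · exact (hsome j p).1 (h _ hj)
      · exact zero_le
  · rintro h ⟨j, _ | p⟩ hq
    · have := (h j (Finset.mem_image_of_mem Prod.fst hq)).1
      simp only [if_pos hq] at this
      exact (hnone j hq).2 this
    · have := (h j (Finset.mem_image_of_mem Prod.fst hq)).2 p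
        (Finset.mem_eraseNone.2 (Finset.mem_image_of_mem Prod.snd hq))
      simp only [if_pos hq] at this
      exact (hsome j p).2 this

theorem measurable_logExponents {Ω : Type*} [MeasurableSpace Ω] {v : ℕ → Ω → ℝ}
    {g : ℕ → Nat.Primes → Ω → ℕ} (hv : ∀ j, Measurable (v j)) (hg : ∀ k p, Measurable (g k p)) :
    Measurable fun ω => logExponents (fun j => v j ω) fun k p => g k p ω := by
  refine measurable_pi_lambda _ ?_
  rintro ⟨j, _ | p⟩
  · exact (hv j).log
  · exact (Measurable.of_discrete (f := fun k : ℕ => -(k : ℝ))).comp (hg j p)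

theorem dvd_prod_prime_pow_iff {u : ℕ} (hu : u ≠ 0) (S : Finset Nat.Primes) (a : Nat.Primes → ℕ) :
    ∏ p ∈ S, (p : ℕ) ^ a p ∣ u ↔ ∀ p ∈ S, a p ≤ u.factorization p := by
  constructor
  · intro h p hp
    rw [← p.2.pow_dvd_iff_le_factorization hu]
    exact (Finset.dvd_prod_of_mem _ hp).trans h
  · intro h
    refine Finset.prod_dvd_of_isRelPrime (fun p _ q _ hpq => ?_) fun p hp =>
      (p.2.pow_dvd_iff_le_factorization hu).2 (h p hp)
    exact Nat.coprime_iff_isRelPrime.1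
      (Nat.Coprime.pow _ _ ((Nat.coprime_primes p.2 q.2).2 fun h => hpq (Subtype.ext h)))

theorem measureReal_limit_orthant {Ω : Type*} [MeasurableSpace Ω] {P : Measure Ω}
    [IsProbabilityMeasure P] {V : ℕ → Ω → ℝ} {G : ℕ → Nat.Primes → Ω → ℕ}
    (hV_meas : ∀ j, Measurable (V j)) (hV_indep : iIndepFun V P)
    (hV_law : ∀ j, P.map (V j) = volume.restrict (Set.Icc (0 : ℝ) 1))
    (hG_indep : iIndepFun (fun q : ℕ × Nat.Primes => G q.1 q.2) P)
    (hG_law : ∀ k (p : Nat.Primes) (j : ℕ), P {ω | j ≤ G k p ω} = (((p : ℕ) : ℝ≥0∞) ^ j)⁻¹)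
    (hVG_indep : IndepFun (fun ω j => V j ω)
      (fun ω (q : ℕ × Nat.Primes) => G q.1 q.2 ω) P)
    (J : Finset ℕ) (S : Finset Nat.Primes) {t : ℕ → ℝ} (ht : ∀ j, 0 ≤ t j ∧ t j ≤ 1)
    (a : ℕ → Nat.Primes → ℕ) :
    P.real {ω | ∀ j ∈ J, V j ω ≤ t j ∧ ∀ p ∈ S, a j p ≤ G j p ω} =
      ∏ j ∈ J, t j / ((∏ p ∈ S, (p : ℕ) ^ a j p : ℕ) : ℝ) := by
  have hA : MeasurableSet {w : ℕ → ℝ | ∀ j ∈ J, w j ≤ t j} := by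
    have : {w : ℕ → ℝ | ∀ j ∈ J, w j ≤ t j} = ⋂ j ∈ J, {w | w j ≤ t j} := by ext w; simp
    rw [this]
    exact Finset.measurableSet_biInter _ fun i _ =>
      measurableSet_le (measurable_pi_apply i) measurable_const
  have hB : MeasurableSet {w : ℕ × Nat.Primes → ℕ | ∀ q ∈ J ×ˢ S, a q.1 q.2 ≤ w q} := by
    have : {w : ℕ × Nat.Primes → ℕ | ∀ q ∈ J ×ˢ S, a q.1 q.2 ≤ w q} =
        ⋂ q ∈ J ×ˢ S, {w | a q.1 q.2 ≤ w q} := by ext w; simp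
    rw [this]
    exact Finset.measurableSet_biInter _ fun i _ =>
      measurableSet_le measurable_const (measurable_pi_apply i)
  have hV : ∀ j, P (V j ⁻¹' Set.Iic (t j)) = ENNReal.ofReal (t j) := fun j => by
    rw [← Measure.map_apply (hV_meas j) measurableSet_Iic, hV_law j,
      Measure.restrict_apply measurableSet_Iic]
    have : Set.Iic (t j) ∩ Set.Icc 0 1 = Set.Icc 0 (t j) := by
      ext y
      simp only [Set.mem_inter_iff, Set.mem_Iic, Set.mem_Icc]
      exact ⟨fun h => ⟨h.2.1, h.1⟩, fun h => ⟨h.2, h.1, h.2.trans (ht j).2⟩⟩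
    rw [this, Real.volume_Icc, sub_zero]
  have hset : {ω | ∀ j ∈ J, V j ω ≤ t j ∧ ∀ p ∈ S, a j p ≤ G j p ω} =
      (fun ω j => V j ω) ⁻¹' {w | ∀ j ∈ J, w j ≤ t j} ∩
        (fun ω (q : ℕ × Nat.Primes) => G q.1 q.2 ω) ⁻¹' {w | ∀ q ∈ J ×ˢ S, a q.1 q.2 ≤ w q} := by
    ext ω
    simp only [Set.mem_ofPred_eq, Set.mem_inter_iff, Set.mem_preimage, Finset.mem_product,
      Prod.forall]
    exact ⟨fun h => ⟨fun j hj => (h j hj).1, fun j p hq => (h j hq.1).2 p hq.2⟩,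
      fun h j hj => ⟨h.1 j hj, fun p hp => h.2 j p ⟨hj, hp⟩⟩⟩
  have h1 : P ((fun ω j => V j ω) ⁻¹' {w | ∀ j ∈ J, w j ≤ t j}) =
      ∏ j ∈ J, ENNReal.ofReal (t j) := by
    rw [← Finset.prod_congr rfl fun j _ => hV j,
      ← hV_indep.measure_inter_preimage_eq_mul J fun j _ => measurableSet_Iic]
    congr 1
    ext ω
    simp
  have h2 : P ((fun ω (q : ℕ × Nat.Primes) => G q.1 q.2 ω) ⁻¹'
      {w | ∀ q ∈ J ×ˢ S, a q.1 q.2 ≤ w q}) =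
      ∏ q ∈ J ×ˢ S, (((q.2 : ℕ) : ℝ≥0∞) ^ a q.1 q.2)⁻¹ := by
    rw [← Finset.prod_congr rfl fun (q : ℕ × Nat.Primes) _ => hG_law q.1 q.2 (a q.1 q.2)]
    have := hG_indep.measure_inter_preimage_eq_mul (J ×ˢ S)
      (sets := fun q => {k : ℕ | a q.1 q.2 ≤ k}) fun q _ => MeasurableSet.of_discrete
    refine Eq.trans ?_ this
    congr 1
    ext ω
    simp
  rw [measureReal_def, hset, hVG_indep.measure_inter_preimage_eq_mul _ _ hA hB, h1, h2,
    ENNReal.toReal_mul, ENNReal.toReal_prod, ENNReal.toReal_prod, Finset.prod_product,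
    ← Finset.prod_mul_distrib]
  refine Finset.prod_congr rfl fun j _ => ?_
  rw [ENNReal.toReal_ofReal (ht j).1, div_eq_mul_inv]
  congr 1
  push_cast
  rw [← Finset.prod_inv_distrib]
  exact Finset.prod_congr rfl fun p _ => by simp

/-- Independence is used only across `j`. For fixed `j`, coprimality of prime powers merges all
conditions into `u ≤ t n` and `Q ∣ u`; independence between size and primes emerges only as `n → ∞`.
-/
theorem measureReal_uniform_orthant {Ω : Type*} [MeasurableSpace Ω] {μ : Measure Ω}
    [IsProbabilityMeasure μ] {n : ℕ} (hn : n ≠ 0) {U : ℕ → Ω → ℕ}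
    (hU_meas : ∀ j, Measurable (U j)) (hU_indep : iIndepFun U μ)
    (hU_law : ∀ j, ∀ k ∈ Finset.Icc 1 n, μ {ω | U j ω = k} = (n : ℝ≥0∞)⁻¹)
    (J : Finset ℕ) (S : Finset Nat.Primes) {t : ℕ → ℝ} (ht : ∀ j, 0 ≤ t j ∧ t j ≤ 1)
    (a : ℕ → Nat.Primes → ℕ) :
    μ.real {ω | ∀ j ∈ J, (U j ω : ℝ) / n ≤ t j ∧ ∀ p ∈ S, a j p ≤ (U j ω).factorization p} =
      ∏ j ∈ J, ((⌊t j * n⌋₊ / ∏ p ∈ S, (p : ℕ) ^ a j p : ℕ) : ℝ) * (n : ℝ)⁻¹ := by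
  classical
  let D : ℕ → Set ℕ := fun j => {u | (u : ℝ) / n ≤ t j ∧ ∀ p ∈ S, a j p ≤ u.factorization p}
  have hset : {ω | ∀ j ∈ J, (U j ω : ℝ) / n ≤ t j ∧ ∀ p ∈ S, a j p ≤ (U j ω).factorization p} =
      ⋂ j ∈ J, U j ⁻¹' D j := by
    ext ω; simp [D]
  rw [measureReal_def, hset, hU_indep.measure_inter_preimage_eq_mul J
    fun _ _ => MeasurableSet.of_discrete, ENNReal.toReal_prod]
  refine Finset.prod_congr rfl fun j _ => ?_
  rw [measure_uniform_mem hn (hU_meas j) (hU_law j), ENNReal.toReal_mul, ENNReal.toReal_inv,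
    ENNReal.toReal_natCast, ENNReal.toReal_natCast, ← card_filter_dvd_le (ht j).1 (ht j).2]
  congr 3
  refine Finset.filter_congr fun u hu => ?_
  have hu0 : u ≠ 0 := by have := (Finset.mem_Icc.1 hu).1; lia
  have hn0 : (0 : ℝ) < n := by exact_mod_cast Nat.pos_of_ne_zero hn
  rw [dvd_prod_prime_pow_iff hu0, ← div_le_iff₀ hn0]
  rfl

end RandomLcm

/-! ### Collisions, truncation error of the sample, and continuity -/

namespace RandomLcm

section Sample

variable {Ω : Type*} [MeasurableSpace Ω] {μ : Measure Ω} {n : ℕ} {U : ℕ → Ω → ℕ}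

theorem measure_pair_le_of_indep {g : ℕ → Nat.Primes → Ω → ℕ} {i j : ℕ} {p : Nat.Primes}
    (hind : IndepFun (g i p) (g j p) μ)
    (hlaw : ∀ k a, μ {ω | a ≤ g k p ω} ≤ (((p : ℕ) : ℝ≥0∞) ^ a)⁻¹) (a : ℕ) :
    μ {ω | a ≤ g i p ω ∧ a ≤ g j p ω} ≤ ((((p : ℕ) : ℝ≥0∞) ^ a)⁻¹) ^ 2 := by
  have h := hind.measure_inter_preimage_eq_mul {k | a ≤ k} {k | a ≤ k}
    MeasurableSet.of_discrete MeasurableSet.of_discrete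
  refine Eq.trans_le h ?_
  rw [sq]
  exact mul_le_mul' (hlaw i a) (hlaw j a)

variable [IsProbabilityMeasure μ]

theorem measure_uniform_eq_le (hn : n ≠ 0) (hU_meas : ∀ j, Measurable (U j))
    (hU_indep : iIndepFun U μ)
    (hU_law : ∀ j, ∀ k ∈ Finset.Icc 1 n, μ {ω | U j ω = k} = (n : ℝ≥0∞)⁻¹) {i j : ℕ}
    (hij : i ≠ j) : μ {ω | U i ω = U j ω} ≤ (n : ℝ≥0∞)⁻¹ := by
  have hn' : (n : ℝ≥0∞) ≠ 0 := by exact_mod_cast hn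
  calc μ {ω | U i ω = U j ω}
      ≤ μ (⋃ k ∈ Finset.Icc 1 n, U i ⁻¹' {k} ∩ U j ⁻¹' {k}) := by
        refine measure_mono_ae ?_
        filter_upwards [ae_uniform_mem_Icc hn (hU_meas i) (hU_law i)] with ω hω h
        exact Set.mem_biUnion hω ⟨rfl, Eq.symm h⟩
    _ ≤ ∑ k ∈ Finset.Icc 1 n, μ (U i ⁻¹' {k} ∩ U j ⁻¹' {k}) := measure_biUnion_finset_le _ _
    _ = ∑ k ∈ Finset.Icc 1 n, (n : ℝ≥0∞)⁻¹ * (n : ℝ≥0∞)⁻¹ := by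
        refine Finset.sum_congr rfl fun k hk => ?_
        rw [(hU_indep.indepFun hij).measure_inter_preimage_eq_mul _ _
          (measurableSet_singleton k) (measurableSet_singleton k)]
        exact congrArg₂ _ (hU_law i k hk) (hU_law j k hk)
    _ = (n : ℝ≥0∞)⁻¹ := by
        rw [Finset.sum_const, Nat.card_Icc, Nat.add_sub_cancel, nsmul_eq_mul, ← mul_assoc,
          ENNReal.mul_inv_cancel hn' (ENNReal.natCast_ne_top n), one_mul]

theorem lintegral_min_edist_logLcmCentered_le (hn : n ≠ 0) (hU_meas : ∀ j, Measurable (U j))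
    (hU_indep : iIndepFun U μ)
    (hU_law : ∀ j, ∀ k ∈ Finset.Icc 1 n, μ {ω | U j ω = k} = (n : ℝ≥0∞)⁻¹) {m : ℕ} (hmn : m ≤ n)
    (S : Finset Nat.Primes) :
    ∫⁻ ω, min 1 (edist (logLcmCentered n m fun j => U j ω)
        (truncatedValue S m (fun j => (U j ω : ℝ) / n) fun k p => (U k ω).factorization p)) ∂μ ≤
      m * m * (n : ℝ≥0∞)⁻¹ + ∑' p : {p // p ∉ S}, momentBound m p := by
  -- `B` is the event of a repetition among the first `m` draws. There the cap `min 1` suffices; off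
  -- `B` the identity with `limitValue` is exact.
  let B : Set Ω := ⋃ i ∈ Finset.range m, ⋃ j ∈ (Finset.range m).erase i, {ω | U i ω = U j ω}
  have hB : MeasurableSet B := Finset.measurableSet_biUnion _ fun i _ =>
    Finset.measurableSet_biUnion _ fun j _ => measurableSet_eq_fun (hU_meas i) (hU_meas j)
  have hμB : μ B ≤ m * m * (n : ℝ≥0∞)⁻¹ := by
    calc μ B ≤ ∑ i ∈ Finset.range m, μ (⋃ j ∈ (Finset.range m).erase i, {ω | U i ω = U j ω}) :=
          measure_biUnion_finset_le _ _
      _ ≤ ∑ i ∈ Finset.range m, ∑ j ∈ Finset.range m, (n : ℝ≥0∞)⁻¹ := by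
          refine Finset.sum_le_sum fun i _ => (measure_biUnion_finset_le _ _).trans ?_
          refine le_trans (Finset.sum_le_sum fun j hj => measure_uniform_eq_le hn hU_meas hU_indep
            hU_law (Finset.ne_of_mem_erase hj).symm) ?_
          exact Finset.sum_le_sum_of_subset (Finset.erase_subset _ _)
      _ = m * m * (n : ℝ≥0∞)⁻¹ := by simp [mul_assoc]
  have hg : ∀ (k : ℕ) (p : Nat.Primes), Measurable fun ω => (U k ω).factorization p := fun k p =>
    (Measurable.of_discrete (f := fun u : ℕ => u.factorization p)).comp (hU_meas k)
  have hpair : ∀ i j, i ≠ j → ∀ (p : Nat.Primes) (a : ℕ),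
      μ {ω | a ≤ (U i ω).factorization p ∧ a ≤ (U j ω).factorization p} ≤
        ((((p : ℕ) : ℝ≥0∞) ^ a)⁻¹) ^ 2 := fun i j hij p a =>
    measure_pair_le_of_indep (g := fun k p ω => (U k ω).factorization p)
      ((hU_indep.indepFun hij).comp (φ := fun u : ℕ => u.factorization p)
        (ψ := fun u : ℕ => u.factorization p) Measurable.of_discrete Measurable.of_discrete)
      (fun k a => measure_uniform_le_factorization hn (hU_meas k) (hU_law k) p a) a
  have hae : ∀ᵐ ω ∂μ, ∀ j, U j ω ∈ Finset.Icc 1 n :=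
    ae_all_iff.2 fun j => ae_uniform_mem_Icc hn (hU_meas j) (hU_law j)
  calc ∫⁻ ω, min 1 (edist (logLcmCentered n m fun j => U j ω)
        (truncatedValue S m (fun j => (U j ω : ℝ) / n) fun k p => (U k ω).factorization p)) ∂μ
      ≤ ∫⁻ ω, (B.indicator (fun _ => 1) ω +
          edist (limitValue m (fun j => (U j ω : ℝ) / n) fun k p => (U k ω).factorization p)
          (truncatedValue S m (fun j => (U j ω : ℝ) / n) fun k p => (U k ω).factorization p)) ∂μ := by
        refine lintegral_mono_ae ?_
        filter_upwards [hae] with ω hω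
        by_cases hωB : ω ∈ B
        · rw [Set.indicator_of_mem hωB]
          exact (min_le_left _ _).trans le_self_add
        · rw [Set.indicator_of_notMem hωB, zero_add, logLcmCentered_eq_limitValue hn hmn]
          · exact min_le_right _ _
          · intro i hi j hj hij
            by_contra hne
            exact hωB (Set.mem_biUnion hi (Set.mem_biUnion
              (Finset.mem_erase.2 ⟨Ne.symm hne, hj⟩) hij))
          · intro k _
            have := (Finset.mem_Icc.1 (hω k)).1
            lia
    _ = μ B + ∫⁻ ω, edist
          (limitValue m (fun j => (U j ω : ℝ) / n) fun k p => (U k ω).factorization p)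
          (truncatedValue S m (fun j => (U j ω : ℝ) / n) fun k p => (U k ω).factorization p) ∂μ := by
        rw [lintegral_add_left (measurable_const.indicator hB), lintegral_indicator_const hB,
          one_mul]
    _ ≤ _ := add_le_add hμB (lintegral_edist_limitValue_truncatedValue_le hg hpair
        (fun j ω => (U j ω : ℝ) / n) m S)

end Sample

/-- The truncated value as a function of the logarithms and the exponents. -/
noncomputable def truncatedMap (S : Finset Nat.Primes) (w : ℕ × Option Nat.Primes → ℝ) (m : ℕ+) :
    ℝ :=
  ∑ j ∈ Finset.range m, w (j, none) + ∑ p ∈ S, Real.log (p : ℝ) *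
    ((Finset.range (m : ℕ)).sup' (Finset.nonempty_range_iff.2 m.ne_zero) (fun k => -w (k, some p)) +
      ∑ k ∈ Finset.range m, w (k, some p))

/-- Each output depends on finitely many coordinates. Taking `log (v j)` itself as a coordinate
avoids the discontinuity of the logarithm at `0`. -/
theorem continuous_truncatedMap (S : Finset Nat.Primes) : Continuous (truncatedMap S) := by
  refine continuous_pi fun m => ?_
  have hsup : ∀ p : Nat.Primes, Continuous fun w : ℕ × Option Nat.Primes → ℝ =>
      (Finset.range (m : ℕ)).sup' (Finset.nonempty_range_iff.2 m.ne_zero)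
        fun k => -w (k, some p) :=
    fun p => Continuous.finset_sup'_apply _ fun k _ => (continuous_apply _).neg
  unfold truncatedMap
  fun_prop

theorem truncatedMap_logExponents (S : Finset Nat.Primes) (v : ℕ → ℝ) (g : ℕ → Nat.Primes → ℕ)
    (m : ℕ+) : truncatedMap S (logExponents v g) m = truncatedValue S m v g := by
  rw [truncatedMap, truncatedValue]
  congr 1
  refine Finset.sum_congr rfl fun p _ => ?_
  have hne : (Finset.range (m : ℕ)).Nonempty := Finset.nonempty_range_iff.2 m.ne_zero
  have hsup : (Finset.range (m : ℕ)).sup' hne (fun k => -logExponents v g (k, some p)) =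
      (((Finset.range (m : ℕ)).sup fun k => g k p : ℕ) : ℝ) := by
    rw [← Finset.sup'_eq_sup hne,
      Finset.apply_sup'_eq_sup'_comp hne (Nat.cast : ℕ → ℝ) (fun x y => Nat.cast_max x y)]
    exact Finset.sup'_congr hne rfl fun k _ => by simp [logExponents]
  rw [hsup, limitTerm]
  simp only [logExponents, Finset.sum_neg_distrib]
  ring

end RandomLcm

/-! ### The convergence theorem -/

theorem theorem3p3
    -- for every `n ≥ 1`, independent uniform random variables on `{1, …, n}`
    {Ω : ℕ+ → Type*} [∀ n, MeasurableSpace (Ω n)]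
    (μ : ∀ n, Measure (Ω n)) [∀ n, IsProbabilityMeasure (μ n)]
    (U : ∀ n, ℕ → Ω n → ℕ)
    (hU_meas : ∀ n j, Measurable (U n j))
    (hU_indep : ∀ n, iIndepFun (U n) (μ n))
    (hU_law : ∀ (n : ℕ+) (j : ℕ), ∀ k ∈ Finset.Icc 1 (n : ℕ), μ n {ω | U n j ω = k} = ((n : ℕ) : ℝ≥0∞)⁻¹)
    -- independent uniform variables `V j` on `[0, 1]` and, independent of them, independent
    -- geometric variables `G k p`
    {Ω' : Type*} [MeasurableSpace Ω'] (P : Measure Ω') [IsProbabilityMeasure P]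
    (V : ℕ → Ω' → ℝ) (G : ℕ → Nat.Primes → Ω' → ℕ)
    (hV_meas : ∀ j, Measurable (V j))
    (hG_meas : ∀ k p, Measurable (G k p))
    (hV_indep : iIndepFun V P)
    (hV_law : ∀ j, P.map (V j) = volume.restrict (Set.Icc (0 : ℝ) 1))
    (hG_indep : iIndepFun (fun q : ℕ × Nat.Primes => G q.1 q.2) P)
    (hG_law : ∀ k (p : Nat.Primes) (j : ℕ), P {ω | j ≤ G k p ω} = (((p : ℕ) : ℝ≥0∞) ^ j)⁻¹)
    (hVG_indep : IndepFun (fun ω j => V j ω)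
      (fun ω (q : ℕ × Nat.Primes) => G q.1 q.2 ω) P) :
    -- the series over the primes converge almost surely, and the sequences indexed by `m ≥ 1`
    -- converge in distribution in `ℝ^∞` with the product topology
    (∀ᵐ ω ∂P, ∀ m : ℕ+, Summable (RandomLcm.limitTerm m (fun k p => G k p ω))) ∧
    TendstoInDistribution
      (fun (n : ℕ+) (ω : Ω n) (m : ℕ+) => RandomLcm.logLcmCentered n m (fun j => U n j ω))
      atTop
      (fun (ω : Ω') (m : ℕ+) => RandomLcm.limitValue m (fun j => V j ω) (fun k p => G k p ω))
      μ P := by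
  have hg : ∀ n (k : ℕ) (p : Nat.Primes), Measurable fun ω => (U n k ω).factorization p :=
    fun n k p =>
      (Measurable.of_discrete (f := fun u : ℕ => u.factorization p)).comp (hU_meas n k)
  have hv : ∀ (n : ℕ+) j, Measurable fun ω => (U n j ω : ℝ) / (n : ℕ) := fun n j =>
    (Measurable.of_discrete (f := fun u : ℕ => (u : ℝ) / (n : ℕ))).comp (hU_meas n j)
  have hpair : ∀ i j, i ≠ j → ∀ (p : Nat.Primes) (a : ℕ),
      P {ω | a ≤ G i p ω ∧ a ≤ G j p ω} ≤ ((((p : ℕ) : ℝ≥0∞) ^ a)⁻¹) ^ 2 := fun i j hij p a =>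
    RandomLcm.measure_pair_le_of_indep
      (hG_indep.indepFun (i := (i, p)) (j := (j, p)) (by simpa using hij))
      (fun k a => (hG_law k p a).le) a
  have hU_ae : ∀ n, ∀ᵐ ω ∂μ n, ∀ j, 0 < (U n j ω : ℝ) / (n : ℕ) ∧ (U n j ω : ℝ) / (n : ℕ) ≤ 1 := by
    refine fun n => ae_all_iff.2 fun j => ?_
    filter_upwards [RandomLcm.ae_uniform_mem_Icc n.ne_zero (hU_meas n j) (hU_law n j)] with ω hω
    have hn : (0 : ℝ) < (n : ℕ) := Nat.cast_pos.2 n.pos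
    obtain ⟨h1, h2⟩ := Finset.mem_Icc.1 hω
    exact ⟨div_pos (Nat.cast_pos.2 h1) hn, (div_le_one hn).2 (Nat.cast_le.2 h2)⟩
  have hV_ae : ∀ᵐ ω ∂P, ∀ j, 0 < V j ω ∧ V j ω ≤ 1 := by
    refine ae_all_iff.2 fun j => ?_
    have h : ∀ᵐ y ∂P.map (V j), 0 < y ∧ y ≤ 1 := by
      -- The endpoint `0`, where the logarithm takes a junk value, is a null set.
      rw [hV_law j, ← restrict_Ioc_eq_restrict_Icc]
      exact ae_restrict_mem measurableSet_Ioc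
    exact ae_of_ae_map (hV_meas j).aemeasurable h
  have hlog : TendstoInDistribution
      (fun (n : ℕ+) (ω : Ω n) => RandomLcm.logExponents (fun j => (U n j ω : ℝ) / (n : ℕ))
        fun k p => (U n k ω).factorization p) atTop
      (fun ω => RandomLcm.logExponents (fun j => V j ω) fun k p => G k p ω) μ P := by
    refine tendstoInDistribution_pi_of_tendsto_orthant
      (fun n => RandomLcm.measurable_logExponents (hv n) (hg n))
      (RandomLcm.measurable_logExponents hV_meas hG_meas) fun T x => ?_
    obtain ⟨J, S, t, a, ht, hiff⟩ := RandomLcm.exists_logExponents_orthant_iff T x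
    have hP := RandomLcm.measureReal_limit_orthant hV_meas hV_indep hV_law hG_indep hG_law
      hVG_indep J S ht a
    have hμ := fun n : ℕ+ => RandomLcm.measureReal_uniform_orthant n.ne_zero (hU_meas n)
      (hU_indep n) (hU_law n) J S ht a
    have hP' : P.real {ω | ∀ q ∈ T, RandomLcm.logExponents (fun j => V j ω)
        (fun k p => G k p ω) q ≤ x q} = _ :=
      (measureReal_congr (hV_ae.mono fun ω hω =>
        propext (hiff (fun j => V j ω) (fun k p => G k p ω) hω))).trans hP
    have hμ' : ∀ n, (μ n).real {ω | ∀ q ∈ T, RandomLcm.logExponents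
        (fun j => (U n j ω : ℝ) / (n : ℕ)) (fun k p => (U n k ω).factorization p) q ≤ x q} = _ :=
      fun n => (measureReal_congr ((hU_ae n).mono fun ω hω => propext
        (hiff (fun j => (U n j ω : ℝ) / (n : ℕ)) (fun k p => (U n k ω).factorization p) hω))).trans
          (hμ n)
    rw [hP']
    refine Tendsto.congr (fun n => (hμ' n).symm) ?_
    exact tendsto_finsetProd _ fun j _ =>
      (RandomLcm.tendsto_floor_div_div (ht j).1 _).comp tendsto_PNat_val_atTop_atTop
  refine ⟨ae_all_iff.2 fun m => RandomLcm.ae_summable_limitTerm hG_meas hpair m, ?_⟩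
  have htail : ∀ m : ℕ, ∀ δ > 0, ∀ᶠ S : Finset Nat.Primes in atTop,
      ∑' p : {p // p ∉ S}, RandomLcm.momentBound m p ≤ δ := fun m δ hδ =>
    (ENNReal.tendsto_tsum_compl_atTop_zero (RandomLcm.tsum_momentBound_ne_top m)).eventually_le_const
      hδ
  refine tendstoInDistribution_pi_of_approx (L := (atTop : Filter (Finset Nat.Primes)))
    (Y := fun S n ω => RandomLcm.truncatedMap S (RandomLcm.logExponents
      (fun j => (U n j ω : ℝ) / (n : ℕ)) fun k p => (U n k ω).factorization p))
    (W := fun S ω => RandomLcm.truncatedMap S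
      (RandomLcm.logExponents (fun j => V j ω) fun k p => G k p ω)) ?_ ?_ ?_ ?_ ?_
  · exact fun n => (measurable_pi_lambda _ fun m : ℕ+ =>
      (RandomLcm.measurable_logLcmCentered n m).comp
        (measurable_pi_lambda _ fun j => hU_meas n j)).aemeasurable
  · exact (measurable_pi_lambda _ fun m : ℕ+ =>
      RandomLcm.measurable_limitValue hV_meas hG_meas).aemeasurable
  · exact fun S => hlog.continuous_comp (RandomLcm.continuous_truncatedMap S)
  · intro m δ hδ
    have hδ2 : 0 < δ / 2 := ENNReal.half_pos hδ.ne'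
    have hlim : Tendsto (fun n : ℕ+ => (m : ℝ≥0∞) * m * ((n : ℕ) : ℝ≥0∞)⁻¹) atTop (nhds 0) := by
      have h := ENNReal.Tendsto.const_mul (a := (m : ℝ≥0∞) * m)
        (ENNReal.tendsto_inv_nat_nhds_zero.comp tendsto_PNat_val_atTop_atTop)
        (Or.inr (ENNReal.mul_ne_top (by simp) (by simp)))
      simpa using h
    -- `S` is fixed before `n`: the prime tail is small uniformly in `n`. Afterwards `n ≥ m` makes
    -- `min m n = m`, and the collision term `m² / n` vanishes.
    filter_upwards [htail m (δ / 2) hδ2] with S hS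
    filter_upwards [eventually_ge_atTop m, hlim.eventually_le_const hδ2] with n hmn hn
    simp_rw [RandomLcm.truncatedMap_logExponents]
    refine (RandomLcm.lintegral_min_edist_logLcmCentered_le n.ne_zero (hU_meas n) (hU_indep n)
      (hU_law n) (PNat.coe_le_coe _ _ |>.2 hmn) S).trans ?_
    exact (add_le_add hn hS).trans_eq (ENNReal.add_halves δ)
  · intro m δ hδ
    filter_upwards [htail m δ hδ] with S hS
    simp_rw [RandomLcm.truncatedMap_logExponents]
    exact ((lintegral_mono fun ω => min_le_right _ _).trans
      (RandomLcm.lintegral_edist_limitValue_truncatedValue_le hG_meas hpair V m S)).trans hS
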